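/- Let $(E,d)$ be a metric space and $B(t,r)=\{x\in E: d(x,t)\le r\}$. For $x\in E$ let $F(\cdot,x)$ be the distribution function of a law on $\mathbb R$, let $q(\alpha,x)\in(0,\infty)$, $\alpha\in(0,1)$, satisfy $F(q(\alpha,x),x)=1-\alpha$, and let $\gamma(x)>0$ be such that $\lim_{\alpha\downarrow 0} q(\lambda\alpha,x)/q(\alpha,x)=\lambda^{-\gamma(x)}$ for all $\lambda>0$. Fix $t\in E$ and assume that $\alpha\mapsto q(\alpha,t)$ is differentiable on $(0,1)$ and that $\Delta(\alpha,t)=\gamma(t)+\alpha\,\frac{\partial\log q}{\partial\alpha}(\alpha,t)$ is continuous in $\alpha\in(0,1)$ with $\lim_{\alpha\downarrow 0}\Delta(\alpha,t)=0$. Let $h_n>0$ with $h_n\to 0$. For each $n$ let $x_1,\dots,x_n\in E$ be nonrandom design points (they may depend on $n$) and let $Y_1,\dots,Y_n$ be independent random variables, $Y_i$ having distribution function $F(\cdot,x_i)$. Let $m=m_n$ be the number of indices $i\le n$ with $x_i\in B(t,h_n)$, let $Z_1,\dots,Z_m$ be the corresponding responses $Y_i$, and let $Z_{1,m}\le\dots\le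 Z_{m,m}$ be their order statistics. For $a\in(0,1/2)$ put $$\omega_n(a)=\sup\Big\{\Big|\log\frac{q(\alpha,x)}{q(\alpha,x')}\Big| : \alpha\in(a,1-a),\ x,x'\in B(t,h_n)\Big\}\in[0,\infty].$$ Let $k=k_n$ be integers with $1\le k_n\le m_n$ for all large $n$, such that $k_n/m_n\to 0$ and, for some $\delta>0$, $k_n^2\,\omega_n\big(m_n^{-(1+\delta)}\big)\to 0$. Then for each $n$ there exist, on the probability space of $Y_1,\dots,Y_n$, an event $A_n$, independent random variables $V_1,\dots,V_{m}$ uniformly distributed on $(0,1)$, with order statistics $V_{1,m}\le\dots\le V_{m,m}$, and random variables $T_1,\dots,T_{k}$ with values in $B(t,h_n)$, such that $\mathbb P(A_n)\to 1$ as $n\to\infty$ and, for all $n$ with $k_n\le m_n$, the random vectors $(\log Z_{m-i+1,m})_{1\le i\le k}$ and $(\log q(V_{i,m},T_i))_{1\le i\le k}$ have the same conditional distribution given $A_n$ (a condition without content when $\mathbb P(A_n)=0$, which can happen for finitely many $n$ only). -/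

import Mathlib

open MeasureTheory ProbabilityTheory Filter Topology Set
open scoped ENNReal

noncomputable section

/-- The conditional law of the response given the covariate `x` is `μ x`, with distribution
function `F(·, x) = cdf (μ x)`. The predicate says that `q · x` is the quantile function,
`F(q(α, x), x) = 1 - α`, that it is positive (the responses live in `(0, ∞)`), and that it is
regularly varying at `0` with index `-γ(x)`, where the tail index `γ(x)` is positive.
Only the values `q α x` with `α ∈ (0, 1)` are constrained. -/
structure IsHeavyTailedModel {E : Type*} (μ : E → Measure ℝ) (q : ℝ → E → ℝ) (γ : E → ℝ) :
    Prop where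
  quantile : ∀ x, ∀ α ∈ Ioo (0 : ℝ) 1, cdf (μ x) (q α x) = 1 - α
  pos : ∀ x, ∀ α ∈ Ioo (0 : ℝ) 1, 0 < q α x
  index_pos : ∀ x, 0 < γ x
  regularlyVarying : ∀ x, ∀ c : ℝ, 0 < c →
    Tendsto (fun α => q (c * α) x / q α x) (𝓝[>] 0) (𝓝 (c ^ (-γ x)))

/-- `Δ(α, t) = γ(t) + α ∂ log q / ∂α (α, t)`. -/
def tailDelta {E : Type*} (q : ℝ → E → ℝ) (γ : E → ℝ) (α : ℝ) (t : E) : ℝ :=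
  γ t + α * deriv (fun a => Real.log (q a t)) α

/-- Smoothness of the quantile function at `t`: it is differentiable on `(0, 1)`, and
`Δ(·, t)` is continuous on `(0, 1)` and tends to `0` at `0`. -/
structure IsSmoothTail {E : Type*} (q : ℝ → E → ℝ) (γ : E → ℝ) (t : E) : Prop where
  differentiable : ∀ α ∈ Ioo (0 : ℝ) 1, DifferentiableAt ℝ (fun a => q a t) α
  continuous : ContinuousOn (fun α => tailDelta q γ α t) (Ioo 0 1)
  tendsto_zero : Tendsto (fun α => tailDelta q γ α t) (𝓝[>] 0) (𝓝 0)

/-- The largest oscillation of the log-quantile function in its second variable over the closed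
ball `B(t, r)`, for `α ∈ (a, 1 - a)`. It is an extended nonnegative real, so that an unbounded
oscillation is `∞`. -/
def quantileOscillation {E : Type*} [MetricSpace E] (q : ℝ → E → ℝ) (t : E) (r a : ℝ) : ℝ≥0∞ :=
  ⨆ α ∈ Ioo a (1 - a), ⨆ x ∈ Metric.closedBall t r, ⨆ x' ∈ Metric.closedBall t r,
    ENNReal.ofReal |Real.log (q α x / q α x')|

open Classical in
/-- The indices of the design points lying in the closed ball `B(t, r)`. -/
def slice {E : Type*} [MetricSpace E] {n : ℕ} (x : Fin n → E) (t : E) (r : ℝ) :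
    Finset (Fin n) :=
  Finset.univ.filter (fun i => x i ∈ Metric.closedBall t r)

/-- The number of observations in the slice. -/
def sliceCard {E : Type*} [MetricSpace E] {n : ℕ} (x : Fin n → E) (t : E) (r : ℝ) : ℕ :=
  (slice x t r).card

/-- The responses `Z_i` whose design points lie in the closed ball `B(t, r)`, listed in the
order of their indices in the sample. -/
def sliceResponse {E : Type*} [MetricSpace E] {n : ℕ} (x : Fin n → E) (t : E) (r : ℝ)
    (y : Fin n → ℝ) (i : Fin (sliceCard x t r)) : ℝ :=
  y ((slice x t r).orderEmbOfFin rfl i)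

/-- Order statistics: `orderStat v i` is the `(i + 1)`-th smallest entry of `v`, where `i` runs
over `0, …, m - 1`. -/
def orderStat {m : ℕ} (v : Fin m → ℝ) (i : Fin m) : ℝ :=
  v (Tuple.sort v i)

end

/-! Put $V_j = 1 - F(Z_j, x_j)$ for the responses in the slice. These are independent uniforms, and
almost surely $Z_j = q(V_j, x_j)$. Let $A_n$ be the event that the $k$ largest responses occur, in
order, at the indices of the $k$ smallest $V_j$, and let $T_i$ be the design point attached to
$V_{i,m}$. On $A_n$ the two vectors agree almost surely, so only $\mathbb P(A_n) \to 1$ needs work.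

Let $w$ be the oscillation $\omega_n(m^{-(1+\delta)})$. If all $V_j$ lie in the range of levels it
covers, each $\log Z_j$ is within $w$ of $\log q(V_j, t)$, so the order is preserved once the latter
values are $2w$ apart. Near $0$, $\log q(\alpha, t)$ falls at least as fast as
$-(\gamma/2)\log\alpha$ (`IsSmoothTail.exists_antitoneOn`), so a spacing $4w\tau/\gamma$ between
uniforms below $\tau$ suffices (`orderStat_rev_eq_of_regular`).

With $\tau = Ck/m$, `measure_uniform_not_regular_le` bounds the failures: an extreme uniform costs
$2m^{-\delta}$, a close pair $4C^2k^2w/\gamma$, and too few points below $\tau$ at most $4/C$. Let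
$n \to \infty$, then $C \to \infty$. -/

/-! ### Order statistics and perturbed orderings -/

theorem orderStat_eq_of_card_le {m : ℕ} {v : Fin m → ℝ} {r : Fin m} {c : ℝ}
    (hlt : (Finset.univ.filter fun j => v j < c).card ≤ r)
    (hgt : (Finset.univ.filter fun j => c < v j).card ≤ r.rev) : orderStat v r = c := by
  have hmono : Monotone (v ∘ Tuple.sort v) := Tuple.monotone_sort v
  apply le_antisymm
  · by_contra! hc
    have hsub : (Finset.Ici r).image (Tuple.sort v) ⊆
        Finset.univ.filter fun j => c < v j := by
      intro j hj
      obtain ⟨s, hs, rfl⟩ := Finset.mem_image.1 hj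
      simp only [Finset.mem_filter, Finset.mem_univ, true_and]
      exact hc.trans_le (hmono (Finset.mem_Ici.1 hs))
    have := Finset.card_le_card hsub
    rw [Finset.card_image_of_injective _ (Tuple.sort v).injective, Fin.card_Ici] at this
    -- `r.rev` has value $m - 1 - r$, one less than the size of `Ici r`.
    rw [Fin.val_rev] at hgt
    omega
  · by_contra! hc
    have hsub : (Finset.Iic r).image (Tuple.sort v) ⊆
        Finset.univ.filter fun j => v j < c := by
      intro j hj
      obtain ⟨s, hs, rfl⟩ := Finset.mem_image.1 hj
      simp only [Finset.mem_filter, Finset.mem_univ, true_and]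
      exact (hmono (Finset.mem_Iic.1 hs)).trans_lt hc
    have := Finset.card_le_card hsub
    rw [Finset.card_image_of_injective _ (Tuple.sort v).injective, Fin.card_Iic] at this
    omega

/-- Only comparisons with `z (σ i)` enter, so `σ` need not sort `z` beyond the top ranks. -/
theorem orderStat_rev_eq_of_perm {m : ℕ} {z : Fin m → ℝ} (σ : Equiv.Perm (Fin m)) {i : Fin m}
    (hbefore : ∀ j < i, z (σ i) ≤ z (σ j)) (hafter : ∀ j, i < j → z (σ j) ≤ z (σ i)) :
    orderStat z i.rev = z (σ i) := by
  apply orderStat_eq_of_card_le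
  · have hsub : (Finset.univ.filter fun j => z j < z (σ i)) ⊆ (Finset.Ioi i).image σ := by
      intro j hj
      refine Finset.mem_image.2 ⟨σ.symm j, Finset.mem_Ioi.2 ?_, by simp⟩
      by_contra! hle
      have hj' := (Finset.mem_filter.1 hj).2
      rcases hle.lt_or_eq with hl | hl
      · have := hbefore _ hl
        simp only [Equiv.apply_symm_apply] at this
        linarith
      · rw [← hl] at hj'
        simp at hj'
    refine (Finset.card_le_card hsub).trans ?_
    rw [Finset.card_image_of_injective _ σ.injective, Fin.card_Ioi, Fin.val_rev]
    omega
  · have hsub : (Finset.univ.filter fun j => z (σ i) < z j) ⊆ (Finset.Iio i).image σ := by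
      intro j hj
      refine Finset.mem_image.2 ⟨σ.symm j, Finset.mem_Iio.2 ?_, by simp⟩
      by_contra! hle
      have hj' := (Finset.mem_filter.1 hj).2
      rcases hle.lt_or_eq with hl | hl
      · have := hafter _ hl
        simp only [Equiv.apply_symm_apply] at this
        linarith
      · rw [hl] at hj'
        simp at hj'
    refine (Finset.card_le_card hsub).trans ?_
    rw [Finset.card_image_of_injective _ σ.injective, Fin.card_Iio, Fin.rev_rev]

theorem apply_sort_le_of_lt_card {m : ℕ} {u : Fin m → ℝ} {τ : ℝ} {i : Fin m}
    (hcard : (i : ℕ) < (Finset.univ.filter fun j => u j ≤ τ).card) :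
    u (Tuple.sort u i) ≤ τ := by
  by_contra! hc
  have hmono : Monotone (u ∘ Tuple.sort u) := Tuple.monotone_sort u
  have hsub : (Finset.univ.filter fun j => u j ≤ τ) ⊆ (Finset.Iio i).image (Tuple.sort u) := by
    intro j hj
    refine Finset.mem_image.2 ⟨(Tuple.sort u).symm j, Finset.mem_Iio.2 ?_, by simp⟩
    by_contra! hle
    have h1 := hmono hle
    simp only [Function.comp_apply, Equiv.apply_symm_apply] at h1
    have := (Finset.mem_filter.1 hj).2
    linarith
  have := Finset.card_le_card hsub
  rw [Finset.card_image_of_injective _ (Tuple.sort u).injective, Fin.card_Iio] at this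
  omega

/-- If `g` decreases by at least `2 w` between any two of the values `u j` below `τ`, and each
`log (z j)` is within `w` of `g (u j)`, then the largest values `z j` belong, in reverse order, to
the smallest values `u j`. -/
theorem orderStat_rev_eq_of_separated {m k : ℕ} {u z : Fin m → ℝ} {τ w : ℝ} {g : ℝ → ℝ}
    (hpos : ∀ j, 0 < z j) (hz : ∀ j, |Real.log (z j) - g (u j)| ≤ w)
    (hanti : ∀ j l, u j ≤ u l → g (u l) ≤ g (u j))
    (hgap : ∀ j l, j ≠ l → u j ≤ u l → u l ≤ τ → g (u l) + 2 * w ≤ g (u j))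
    (hcard : k < (Finset.univ.filter fun j => u j ≤ τ).card) {i : Fin m} (hi : (i : ℕ) < k) :
    orderStat z i.rev = z (Tuple.sort u i) := by
  have hmono : Monotone (u ∘ Tuple.sort u) := Tuple.monotone_sort u
  have key : ∀ a b : Fin m, (a : ℕ) < k → a < b →
      z (Tuple.sort u b) ≤ z (Tuple.sort u a) := by
    intro a b ha hab
    -- The gap is needed only between ranks `a` and `a + 1`. Since `a + 1 ≤ k`, rank `a + 1` still
    -- lies below `τ`; monotonicity of `g` handles later ranks. The gap `2 * w` absorbs two errors
    -- `w`.
    let c : Fin m := ⟨a + 1, by omega⟩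
    have hac : a < c := Fin.lt_def.2 (by simp [c])
    have hcb : c ≤ b := Fin.le_def.2 (by simp [c]; omega)
    have h1 := hgap _ _ (fun h => hac.ne ((Tuple.sort u).injective h)) (hmono hac.le)
      (apply_sort_le_of_lt_card (i := c) (by simp [c]; omega))
    have h2 := hanti _ _ (hmono hcb)
    have h3 := abs_le.1 (hz (Tuple.sort u a))
    have h4 := abs_le.1 (hz (Tuple.sort u b))
    refine (Real.log_le_log_iff (hpos _) (hpos _)).1 ?_
    linarith [h3.1, h4.2]
  exact orderStat_rev_eq_of_perm _ (fun j hj => key j i (by omega) hj) (fun j hj => key i j hi hj)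

/-! ### Measurability of the sorting permutation -/

instance measurableSpacePermFin (m : ℕ) : MeasurableSpace (Equiv.Perm (Fin m)) := ⊤

/-- Ties are broken by index, so each fibre is cut out by finitely many comparisons of coordinates.
-/
theorem measurable_sort {m : ℕ} : Measurable fun v : Fin m → ℝ => Tuple.sort v := by
  refine measurable_to_countable' fun σ => ?_
  have : (fun v : Fin m → ℝ => Tuple.sort v) ⁻¹' {σ} =
      (⋂ i, ⋂ j, ⋂ _ : i ≤ j, {v | v (σ i) ≤ v (σ j)}) ∩
        ⋂ i, ⋂ j, ⋂ _ : i < j, ({v | v (σ i) = v (σ j)}ᶜ ∪ {_v | σ i < σ j}) := by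
    ext v
    simp only [mem_preimage, mem_singleton_iff, mem_inter_iff, mem_iInter, mem_union,
      mem_compl_iff, mem_ofPred_eq, ← imp_iff_not_or]
    rw [eq_comm, Tuple.eq_sort_iff]
    rfl
  rw [this]
  refine MeasurableSet.inter ?_ ?_
  · exact MeasurableSet.iInter fun i => MeasurableSet.iInter fun j => MeasurableSet.iInter fun _ =>
      measurableSet_le (measurable_pi_apply _) (measurable_pi_apply _)
  · exact MeasurableSet.iInter fun i => MeasurableSet.iInter fun j => MeasurableSet.iInter fun _ =>
      (measurableSet_eq_fun (measurable_pi_apply (σ i)) (measurable_pi_apply (σ j))).compl.union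
        (MeasurableSet.const (σ i < σ j))

theorem Measurable.apply_sort {Ω : Type*} [MeasurableSpace Ω] {m : ℕ} {β : Type*}
    [MeasurableSpace β] {z : Fin m → Ω → β} (hz : ∀ j, Measurable (z j))
    {v : Ω → Fin m → ℝ} (hv : Measurable v) (i : Fin m) :
    Measurable fun ω => z (Tuple.sort (v ω) i) ω := by
  have h1 : Measurable fun p : Equiv.Perm (Fin m) × Ω => z (p.1 i) p.2 :=
    measurable_from_prod_countable_right fun σ => hz (σ i)
  exact h1.comp ((measurable_sort.comp hv).prodMk measurable_id)

theorem measurable_orderStat {m : ℕ} (i : Fin m) :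
    Measurable fun v : Fin m → ℝ => orderStat v i :=
  Measurable.apply_sort (fun j => measurable_pi_apply j) measurable_id i

/-! ### Probability integral transform -/

/-- The distribution function may be flat at level `c`, so the sublevel set can extend past a point
where `c` is attained. The upper bound therefore uses levels `c'` decreasing to `c`. -/
theorem measure_cdf_le {ν : Measure ℝ} [IsProbabilityMeasure ν]
    (hν : ∀ p ∈ Ioo (0 : ℝ) 1, ∃ y, cdf ν y = p) {c : ℝ} (hc : c ∈ Icc (0 : ℝ) 1) :
    ν {y | cdf ν y ≤ c} = ENNReal.ofReal c := by
  have hlt : ∀ c' ∈ Ioo (0 : ℝ) 1, c < c' → ν {y | cdf ν y ≤ c} ≤ ENNReal.ofReal c' := by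
    intro c' hc' hcc'
    obtain ⟨y', rfl⟩ := hν c' hc'
    rw [ofReal_cdf]
    refine measure_mono fun y hy => ?_
    by_contra! h
    exact absurd ((monotone_cdf ν (le_of_lt (by simpa using h))).trans hy) (not_le.2 hcc')
  apply le_antisymm
  · rcases hc.2.lt_or_eq with h1 | rfl
    · refine ge_of_tendsto (x := 𝓝[>] c) (f := fun c' => ENNReal.ofReal c')
        ((ENNReal.continuous_ofReal.tendsto c).mono_left nhdsWithin_le_nhds) ?_
      filter_upwards [Ioo_mem_nhdsGT h1] with c' hc'
      exact hlt c' ⟨hc.1.trans_lt hc'.1, hc'.2⟩ hc'.1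
    · simpa using prob_le_one
  · rcases hc.2.lt_or_eq with h1 | rfl
    · rcases hc.1.lt_or_eq with h0 | rfl
      · obtain ⟨y, rfl⟩ := hν c ⟨h0, h1⟩
        rw [ofReal_cdf]
        exact measure_mono fun z hz => monotone_cdf ν hz
      · simp
    · have : {y | cdf ν y ≤ 1} = univ := eq_univ_of_forall fun y => cdf_le_one ν y
      simp [this]

/-- The probability integral transform, for the survival function. -/
theorem map_one_sub_cdf {ν : Measure ℝ} [IsProbabilityMeasure ν]
    (hν : ∀ p ∈ Ioo (0 : ℝ) 1, ∃ y, cdf ν y = p) :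
    ν.map (fun y => 1 - cdf ν y) = volume.restrict (Ioo (0 : ℝ) 1) := by
  have hmeas : Measurable fun y => 1 - cdf ν y := measurable_const.sub (monotone_cdf ν).measurable
  have : IsProbabilityMeasure (ν.map fun y => 1 - cdf ν y) :=
    Measure.isProbabilityMeasure_map hmeas.aemeasurable
  refine Measure.ext_of_Ici _ _ fun c => ?_
  rw [Measure.map_apply hmeas measurableSet_Ici, Measure.restrict_apply measurableSet_Ici]
  have hpre : (fun y => 1 - cdf ν y) ⁻¹' Ici c = {y | cdf ν y ≤ 1 - c} := by
    ext y
    simp only [mem_preimage, mem_Ici, mem_ofPred_eq]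
    constructor <;> intro h <;> linarith
  rw [hpre]
  rcases le_total c 0 with h0 | h0
  · have h1 : {y | cdf ν y ≤ 1 - c} = univ :=
      eq_univ_of_forall fun y => (cdf_le_one ν y).trans (by linarith)
    have h2 : Ici c ∩ Ioo (0 : ℝ) 1 = Ioo 0 1 :=
      inter_eq_right.2 fun z hz => h0.trans hz.1.le
    simp [h1, h2]
  · rcases le_total c 1 with h1 | h1
    · rw [measure_cdf_le hν ⟨by linarith, by linarith⟩]
      rcases h0.lt_or_eq with h0 | rfl
      · have : Ici c ∩ Ioo (0 : ℝ) 1 = Ico c 1 := by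
          ext z
          simp only [mem_inter_iff, mem_Ici, mem_Ioo, mem_Ico]
          exact ⟨fun h => ⟨h.1, h.2.2⟩, fun h => ⟨h.1, h0.trans_le h.1, h.2⟩⟩
        rw [this, Real.volume_Ico]
      · have : Ici (0 : ℝ) ∩ Ioo (0 : ℝ) 1 = Ioo 0 1 :=
          inter_eq_right.2 fun z hz => hz.1.le
        simp [this]
    · have h2 : Ici c ∩ Ioo (0 : ℝ) 1 = ∅ := by
        ext z
        simp only [mem_inter_iff, mem_Ici, mem_Ioo, mem_empty_iff_false, iff_false]
        intro h
        linarith [h.1, h.2.2]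
      rw [h2, measure_empty, ← nonpos_iff_eq_zero]
      calc ν {y | cdf ν y ≤ 1 - c} ≤ ν {y | cdf ν y ≤ 0} :=
            measure_mono fun y hy => by
              have h3 : cdf ν y ≤ 1 - c := hy
              exact h3.trans (by linarith : 1 - c ≤ 0)
        _ = 0 := by simp [measure_cdf_le hν ⟨le_rfl, zero_le_one⟩]

/-- Up to a null set, a quantile function inverts the survival function. -/
theorem ae_quantile_one_sub_cdf {ν : Measure ℝ} [IsProbabilityMeasure ν] {f : ℝ → ℝ}
    (hf : ∀ α ∈ Ioo (0 : ℝ) 1, cdf ν (f α) = 1 - α) :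
    ∀ᵐ y ∂ν, f (1 - cdf ν y) = y := by
  have hν : ∀ p ∈ Ioo (0 : ℝ) 1, ∃ y, cdf ν y = p := fun p hp =>
    ⟨f (1 - p), by rw [hf _ ⟨by linarith [hp.2], by linarith [hp.1]⟩]; ring⟩
  have hmap := map_one_sub_cdf hν
  have hmeas : Measurable fun y => 1 - cdf ν y := measurable_const.sub (monotone_cdf ν).measurable
  have hmem : ∀ᵐ y ∂ν, 1 - cdf ν y ∈ Ioo (0 : ℝ) 1 := by
    apply ae_of_ae_map (p := fun z => z ∈ Ioo (0 : ℝ) 1) hmeas.aemeasurable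
    rw [hmap]
    exact ae_restrict_mem measurableSet_Ioo
  -- Inversion can fail only on flat pieces of the distribution function. Each contains a rational,
  -- and the countably many levels attained at rationals are null because the transformed law has no
  -- atoms.
  have hne : ∀ᵐ y ∂ν, ∀ r : ℚ, 1 - cdf ν y ≠ 1 - cdf ν r := by
    rw [ae_all_iff]
    intro r
    apply ae_of_ae_map (p := fun z => z ≠ 1 - cdf ν r) hmeas.aemeasurable
    rw [hmap]
    exact Measure.ae_ne _ _
  filter_upwards [hmem, hne] with y hy hyr
  have heq : cdf ν (f (1 - cdf ν y)) = cdf ν y := by rw [hf _ hy]; ring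
  rcases lt_trichotomy (f (1 - cdf ν y)) y with h | h | h
  · obtain ⟨r, hr1, hr2⟩ := exists_rat_btwn h
    have h1 := monotone_cdf ν hr1.le
    have h2 := monotone_cdf ν hr2.le
    exact absurd (by linarith) (hyr r)
  · exact h
  · obtain ⟨r, hr1, hr2⟩ := exists_rat_btwn h
    have h1 := monotone_cdf ν hr1.le
    have h2 := monotone_cdf ν hr2.le
    exact absurd (by linarith) (hyr r)

theorem quantile_anti {ν : Measure ℝ} [IsProbabilityMeasure ν] {f : ℝ → ℝ}
    (hf : ∀ α ∈ Ioo (0 : ℝ) 1, cdf ν (f α) = 1 - α) : AntitoneOn f (Ioo 0 1) := by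
  intro a ha b hb hab
  rcases hab.lt_or_eq with h | rfl
  · by_contra! hlt
    have := monotone_cdf ν hlt.le
    rw [hf _ ha, hf _ hb] at this
    linarith
  · exact le_rfl

/-! ### Spacings and counts in a uniform sample -/

section UniformSample

variable {Ω : Type*} [MeasurableSpace Ω] {P : Measure Ω}

theorem measure_uniform_le {U : Ω → ℝ} (hU : Measurable U)
    (hlaw : P.map U = volume.restrict (Ioo (0 : ℝ) 1)) {τ : ℝ} (hτ : τ ∈ Icc (0 : ℝ) 1) :
    P {ω | U ω ≤ τ} = ENNReal.ofReal τ := by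
  have h1 : P {ω | U ω ≤ τ} = P.map U (Iic τ) := (Measure.map_apply hU measurableSet_Iic).symm
  rw [h1, hlaw, Measure.restrict_apply measurableSet_Iic]
  have h2 : (Iic τ ∩ Ioo 0 1 : Set ℝ) =ᵐ[volume] (Iic τ ∩ Ioc 0 1 : Set ℝ) :=
    (ae_eq_refl _).inter Ioo_ae_eq_Ioc
  have h3 : (Iic τ ∩ Ioc 0 1 : Set ℝ) = Ioc 0 τ := by
    ext z
    simp only [mem_inter_iff, mem_Iic, mem_Ioc]
    exact ⟨fun h => ⟨h.2.1, h.1⟩, fun h => ⟨h.2, h.1, h.2.trans hτ.2⟩⟩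
  rw [measure_congr h2, h3, Real.volume_Ioc, sub_zero]

theorem measure_uniform_notMem_Ioo_le {U : Ω → ℝ} (hU : Measurable U)
    (hlaw : P.map U = volume.restrict (Ioo (0 : ℝ) 1)) {a : ℝ} (ha : 0 ≤ a) :
    P {ω | U ω ∉ Ioo a (1 - a)} ≤ ENNReal.ofReal (2 * a) := by
  have h1 : P {ω | U ω ∉ Ioo a (1 - a)} = P.map U (Ioo a (1 - a))ᶜ :=
    (Measure.map_apply hU measurableSet_Ioo.compl).symm
  rw [h1, hlaw, Measure.restrict_apply measurableSet_Ioo.compl]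
  have hsub : ((Ioo a (1 - a))ᶜ ∩ Ioo 0 1 : Set ℝ) ⊆ Icc 0 a ∪ Icc (1 - a) 1 := by
    rintro z ⟨hz, h0, h1⟩
    by_cases h : z ≤ a
    · exact Or.inl ⟨h0.le, h⟩
    · refine Or.inr ⟨?_, h1.le⟩
      by_contra! h'
      exact hz ⟨not_le.1 h, h'⟩
  refine (measure_mono hsub).trans ((measure_union_le _ _).trans ?_)
  rw [Real.volume_Icc, Real.volume_Icc, ← ENNReal.ofReal_add (by linarith) (by linarith)]
  exact ENNReal.ofReal_le_ofReal (by linarith)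

variable [IsProbabilityMeasure P]

/-- Given `U`, the variable `W` must hit an interval of length `d`. The extra factor `τ`, with `d`
later proportional to `τ`, turns the $m^2$ pairs of the union bound into order $k^2$. -/
theorem measure_uniform_close_le {U W : Ω → ℝ} (hU : Measurable U) (hW : Measurable W)
    (hind : IndepFun U W P) (hUlaw : P.map U = volume.restrict (Ioo (0 : ℝ) 1))
    (hWlaw : P.map W = volume.restrict (Ioo (0 : ℝ) 1)) {τ d : ℝ} (hτ : τ ∈ Icc (0 : ℝ) 1) :
    P {ω | U ω ≤ τ ∧ W ω ∈ Icc (U ω - d) (U ω)} ≤ ENNReal.ofReal d * ENNReal.ofReal τ := by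
  set S : Set (ℝ × ℝ) := {p | p.1 ≤ τ ∧ p.2 ∈ Icc (p.1 - d) p.1} with hS
  have hSm : MeasurableSet S :=
    (measurableSet_le measurable_fst measurable_const).inter
      ((measurableSet_le (measurable_fst.sub measurable_const) measurable_snd).inter
        (measurableSet_le measurable_snd measurable_fst))
  have h1 : P {ω | U ω ≤ τ ∧ W ω ∈ Icc (U ω - d) (U ω)} = P.map (fun ω => (U ω, W ω)) S :=
    (Measure.map_apply (hU.prodMk hW) hSm).symm
  have hprod := (indepFun_iff_map_prod_eq_prod_map_map hU.aemeasurable hW.aemeasurable).1 hind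
  rw [h1, hprod, Measure.prod_apply hSm]
  calc ∫⁻ u, P.map W (Prod.mk u ⁻¹' S) ∂(P.map U)
      ≤ ∫⁻ u, (Iic τ).indicator (fun _ => ENNReal.ofReal d) u ∂(P.map U) := by
        refine lintegral_mono fun u => ?_
        by_cases hu : u ≤ τ
        · rw [indicator_of_mem (mem_Iic.2 hu), hWlaw]
          refine (Measure.restrict_apply_le _ _).trans ?_
          calc volume (Prod.mk u ⁻¹' S) ≤ volume (Icc (u - d) u) :=
                measure_mono fun w hw => hw.2
            _ = ENNReal.ofReal d := by rw [Real.volume_Icc]; congr 1; ring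
        · have : Prod.mk u ⁻¹' S = ∅ := by
            ext w
            simp [hS, hu]
          simp [this]
    _ = ENNReal.ofReal d * P.map U (Iic τ) := lintegral_indicator_const measurableSet_Iic _
    _ = ENNReal.ofReal d * ENNReal.ofReal τ := by
        rw [Measure.map_apply hU measurableSet_Iic]
        congr 1
        exact measure_uniform_le hU hUlaw hτ

/-- Chebyshev's inequality for a sum of independent indicators, whose variance is at most its mean.
-/
theorem measure_card_uniform_le {m : ℕ} {V : Fin m → Ω → ℝ} (hV : ∀ j, Measurable (V j))
    (hind : iIndepFun V P) (hlaw : ∀ j, P.map (V j) = volume.restrict (Ioo (0 : ℝ) 1))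
    {τ : ℝ} (hτ : τ ∈ Icc (0 : ℝ) 1) {k : ℕ} (hk : k < m * τ) :
    P {ω | (Finset.univ.filter fun j => V j ω ≤ τ).card ≤ k} ≤
      ENNReal.ofReal (m * τ / (m * τ - k) ^ 2) := by
  set f : ℝ → ℝ := (Iic τ).indicator 1 with hf
  have hfm : Measurable f := measurable_one.indicator measurableSet_Iic
  have hXm : ∀ j, Measurable fun ω => f (V j ω) := fun j => hfm.comp (hV j)
  have hb : ∀ z, ‖f z‖ ≤ 1 := fun z => by
    by_cases hz : z ≤ τ <;> simp [hf, hz]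
  have hL : ∀ j, MemLp (fun ω => f (V j ω)) 2 P := fun j =>
    MemLp.of_bound (hXm j).aestronglyMeasurable 1 (ae_of_all _ fun ω => hb _)
  have hEX : ∀ j, ∫ ω, f (V j ω) ∂P = τ := by
    intro j
    have : (fun ω => f (V j ω)) = {ω | V j ω ≤ τ}.indicator 1 := rfl
    rw [this, integral_indicator_one (measurableSet_le (hV j) measurable_const), Measure.real,
      measure_uniform_le (hV j) (hlaw j) hτ, ENNReal.toReal_ofReal hτ.1]
  have hsq : ∀ j, ∫ ω, ((fun ω => f (V j ω)) ^ 2) ω ∂P = τ := by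
    intro j
    rw [← hEX j]
    congr 1
    ext ω
    by_cases hz : V j ω ≤ τ <;> simp [hf, indicator, hz]
  set X : Ω → ℝ := ∑ j, fun ω => f (V j ω) with hX
  have hXL : MemLp X 2 P := memLp_finsetSum' _ fun j _ => hL j
  have hmean : ∫ ω, X ω ∂P = m * τ := by
    simp only [hX, Finset.sum_apply]
    rw [integral_finsetSum _ fun j _ => (hL j).integrable one_le_two]
    simp [hEX]
  have hvar : variance X P ≤ m * τ := by
    rw [hX, IndepFun.variance_sum (fun j _ => hL j) fun i _ j _ hij =>
      (hind.indepFun hij).comp hfm hfm]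
    calc ∑ j, variance (fun ω => f (V j ω)) P ≤ ∑ _j : Fin m, τ :=
          Finset.sum_le_sum fun j _ =>
            (variance_le_expectation_sq (hXm j).aestronglyMeasurable).trans (hsq j).le
      _ = m * τ := by simp
  have hcard : ∀ ω, X ω = (Finset.univ.filter fun j => V j ω ≤ τ).card := by
    intro ω
    simp [hX, hf, indicator]
  have hpos : (0 : ℝ) < m * τ - k := by linarith
  calc P {ω | (Finset.univ.filter fun j => V j ω ≤ τ).card ≤ k}
      ≤ P {ω | m * τ - k ≤ |X ω - ∫ ω, X ω ∂P|} := by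
        refine measure_mono fun ω hω => ?_
        have h1 : X ω ≤ k := by
          rw [hcard]
          exact_mod_cast hω
        rw [mem_ofPred_eq, hmean, abs_sub_comm]
        exact le_trans (by linarith) (le_abs_self _)
    _ ≤ ENNReal.ofReal (variance X P / (m * τ - k) ^ 2) := meas_ge_le_variance_div_sq hXL hpos
    _ ≤ ENNReal.ofReal (m * τ / (m * τ - k) ^ 2) :=
        ENNReal.ofReal_le_ofReal (div_le_div_of_nonneg_right hvar (sq_nonneg _))

/-- With high probability, all points of a uniform sample are in `(a, 1 - a)`, more than `k` of
them are at most `τ`, and two points that are at most `τ` are at distance more than `d`. -/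
theorem measure_uniform_not_regular_le {m : ℕ} {V : Fin m → Ω → ℝ} (hV : ∀ j, Measurable (V j))
    (hind : iIndepFun V P) (hlaw : ∀ j, P.map (V j) = volume.restrict (Ioo (0 : ℝ) 1))
    {a d τ : ℝ} (ha : 0 ≤ a) (hd : 0 ≤ d) (hτ : τ ∈ Icc (0 : ℝ) 1) {k : ℕ} (hk : k < m * τ) :
    P {ω | ¬ ((∀ j, V j ω ∈ Ioo a (1 - a)) ∧
        k < (Finset.univ.filter fun j => V j ω ≤ τ).card ∧
        ∀ j l, j ≠ l → V l ω ≤ τ → V j ω ∉ Icc (V l ω - d) (V l ω))} ≤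
      ENNReal.ofReal (2 * (m * a) + m ^ 2 * (d * τ) + m * τ / (m * τ - k) ^ 2) := by
  have hsub : {ω | ¬ ((∀ j, V j ω ∈ Ioo a (1 - a)) ∧
        k < (Finset.univ.filter fun j => V j ω ≤ τ).card ∧
        ∀ j l, j ≠ l → V l ω ≤ τ → V j ω ∉ Icc (V l ω - d) (V l ω))} ⊆
      ((⋃ j, {ω | V j ω ∉ Ioo a (1 - a)}) ∪
        (⋃ p : Fin m × Fin m, {ω | p.1 ≠ p.2 ∧
          (V p.2 ω ≤ τ ∧ V p.1 ω ∈ Icc (V p.2 ω - d) (V p.2 ω))})) ∪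
        {ω | (Finset.univ.filter fun j => V j ω ≤ τ).card ≤ k} := by
    intro ω hω
    by_contra hcon
    simp only [mem_union, mem_iUnion, mem_ofPred_eq, not_or, not_exists, not_not, not_and,
      not_le, Prod.forall] at hcon
    exact hω ⟨hcon.1.1, hcon.2, hcon.1.2⟩
  have h1 : P (⋃ j, {ω | V j ω ∉ Ioo a (1 - a)}) ≤ ENNReal.ofReal (2 * (m * a)) := by
    calc P (⋃ j, {ω | V j ω ∉ Ioo a (1 - a)}) ≤ ∑ j, P {ω | V j ω ∉ Ioo a (1 - a)} :=
          measure_iUnion_fintype_le _ _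
      _ ≤ ∑ _j : Fin m, ENNReal.ofReal (2 * a) :=
          Finset.sum_le_sum fun j _ => measure_uniform_notMem_Ioo_le (hV j) (hlaw j) ha
      _ = ENNReal.ofReal (2 * (m * a)) := by
          rw [Finset.sum_const, Finset.card_univ, Fintype.card_fin, ← ENNReal.ofReal_nsmul,
            nsmul_eq_mul]
          congr 1
          ring
  have h2 : P (⋃ p : Fin m × Fin m, {ω | p.1 ≠ p.2 ∧
      (V p.2 ω ≤ τ ∧ V p.1 ω ∈ Icc (V p.2 ω - d) (V p.2 ω))}) ≤
      ENNReal.ofReal (m ^ 2 * (d * τ)) := by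
    calc _ ≤ ∑ p : Fin m × Fin m, P {ω | p.1 ≠ p.2 ∧
            (V p.2 ω ≤ τ ∧ V p.1 ω ∈ Icc (V p.2 ω - d) (V p.2 ω))} :=
          measure_iUnion_fintype_le _ _
      _ ≤ ∑ _p : Fin m × Fin m, ENNReal.ofReal (d * τ) := by
          refine Finset.sum_le_sum fun p _ => ?_
          by_cases hp : p.1 = p.2
          · simp [hp]
          · rw [ENNReal.ofReal_mul hd]
            refine (measure_mono fun ω hω => hω.2).trans
              (measure_uniform_close_le (hV p.2) (hV p.1) (hind.indepFun (Ne.symm hp)) (hlaw _)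
                (hlaw _) hτ)
      _ = ENNReal.ofReal (m ^ 2 * (d * τ)) := by
          rw [Finset.sum_const, Finset.card_univ, Fintype.card_prod, Fintype.card_fin,
            ← ENNReal.ofReal_nsmul, nsmul_eq_mul]
          congr 1
          push_cast
          ring
  have h3 := measure_card_uniform_le hV hind hlaw hτ hk
  have hτ0 := hτ.1
  refine (measure_mono hsub).trans ((measure_union_le _ _).trans ?_)
  rw [ENNReal.ofReal_add (by positivity) (by positivity),
    ENNReal.ofReal_add (by positivity) (by positivity)]
  exact add_le_add ((measure_union_le _ _).trans (add_le_add h1 h2)) h3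

end UniformSample

/-! ### Separation of quantiles near zero -/

/-- Multiplied by $\alpha$, the derivative is $\Delta(\alpha, t) - \gamma(t)/2$, which is negative
near $0$. -/
theorem IsSmoothTail.exists_antitoneOn {E : Type*} {μ : E → Measure ℝ} {q : ℝ → E → ℝ}
    {γ : E → ℝ} (hmodel : IsHeavyTailedModel μ q γ) {t : E} (hA : IsSmoothTail q γ t) :
    ∃ η ∈ Ioo (0 : ℝ) 1,
      AntitoneOn (fun α => Real.log (q α t) + γ t / 2 * Real.log α) (Ioo 0 η) := by
  have hγ := hmodel.index_pos t
  have hev : ∀ᶠ α in 𝓝[>] (0 : ℝ), tailDelta q γ α t < γ t / 2 :=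
    hA.tendsto_zero.eventually (gt_mem_nhds (half_pos hγ))
  obtain ⟨b, hb, hbsub⟩ := mem_nhdsGT_iff_exists_Ioo_subset.1 hev
  have hb0 : (0 : ℝ) < b := hb
  have hη : 0 < min b (1 / 2) := lt_min hb0 one_half_pos
  refine ⟨min b (1 / 2), ⟨hη, (min_le_right _ _).trans_lt one_half_lt_one⟩, ?_⟩
  have hd : ∀ α ∈ Ioo 0 (min b (1 / 2)), HasDerivAt
      (fun α => Real.log (q α t) + γ t / 2 * Real.log α)
      (deriv (fun a => Real.log (q a t)) α + γ t / 2 * α⁻¹) α := by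
    intro α hα
    have hα1 : α ∈ Ioo (0 : ℝ) 1 :=
      ⟨hα.1, hα.2.trans ((min_le_right _ _).trans_lt one_half_lt_one)⟩
    exact ((hA.differentiable α hα1).log (hmodel.pos t α hα1).ne').hasDerivAt.add
      ((Real.hasDerivAt_log hα.1.ne').const_mul _)
  refine antitoneOn_of_deriv_nonpos (convex_Ioo _ _)
    (fun α hα => (hd α hα).continuousAt.continuousWithinAt) ?_ ?_
  · rw [interior_Ioo]
    exact fun α hα => (hd α hα).differentiableAt.differentiableWithinAt
  · rw [interior_Ioo]
    intro α hα
    rw [(hd α hα).deriv]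
    have h1 : tailDelta q γ α t < γ t / 2 := hbsub ⟨hα.1, hα.2.trans_le (min_le_left _ _)⟩
    rw [tailDelta] at h1
    have h2 : deriv (fun a => Real.log (q a t)) α + γ t / 2 * α⁻¹ =
        (α * deriv (fun a => Real.log (q a t)) α + γ t / 2) / α := by
      field_simp [hα.1.ne']
    rw [h2]
    exact div_nonpos_of_nonpos_of_nonneg (by linarith) hα.1.le

/-- Finiteness matters: `toReal` sends `∞` to `0`. -/
theorem abs_log_sub_log_le_quantileOscillation {E : Type*} [MetricSpace E] {q : ℝ → E → ℝ}
    {t : E} {r a : ℝ} (hfin : quantileOscillation q t r a ≠ ∞) {α : ℝ} (hα : α ∈ Ioo a (1 - a))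
    {x x' : E} (hx : x ∈ Metric.closedBall t r) (hx' : x' ∈ Metric.closedBall t r)
    (hqx : 0 < q α x) (hqx' : 0 < q α x') :
    |Real.log (q α x) - Real.log (q α x')| ≤ (quantileOscillation q t r a).toReal := by
  rw [← Real.log_div hqx.ne' hqx'.ne', ← ENNReal.ofReal_le_iff_le_toReal hfin]
  exact le_iSup₂_of_le α hα (le_iSup₂_of_le x hx (le_iSup₂_of_le x' hx' le_rfl))

theorem orderStat_rev_eq_of_regular {E : Type*} [MetricSpace E] {μ : E → Measure ℝ}
    [∀ x, IsProbabilityMeasure (μ x)] {q : ℝ → E → ℝ} {γ : E → ℝ}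
    (hmodel : IsHeavyTailedModel μ q γ) {t : E} {r a η τ : ℝ} (hr : 0 ≤ r) (ha : 0 ≤ a)
    (hη : AntitoneOn (fun α => Real.log (q α t) + γ t / 2 * Real.log α) (Ioo 0 η))
    (hτη : τ < η) (hfin : quantileOscillation q t r a ≠ ∞)
    {m k : ℕ} {p : Fin m → E} (hp : ∀ j, p j ∈ Metric.closedBall t r) {u : Fin m → ℝ}
    (hu : ∀ j, u j ∈ Ioo a (1 - a)) (hcard : k < (Finset.univ.filter fun j => u j ≤ τ).card)
    (hsep : ∀ j l, j ≠ l → u l ≤ τ →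
      u j ∉ Icc (u l - 4 * (quantileOscillation q t r a).toReal / γ t * τ) (u l))
    {i : Fin m} (hi : (i : ℕ) < k) :
    orderStat (fun j => q (u j) (p j)) i.rev =
      q (u (Tuple.sort u i)) (p (Tuple.sort u i)) := by
  have hu1 : ∀ j, u j ∈ Ioo (0 : ℝ) 1 := fun j =>
    ⟨ha.trans_lt (hu j).1, (hu j).2.trans_le (by linarith)⟩
  have hγ := hmodel.index_pos t
  set w := (quantileOscillation q t r a).toReal with hw
  have hw0 : 0 ≤ w := ENNReal.toReal_nonneg
  refine orderStat_rev_eq_of_separated (z := fun j => q (u j) (p j))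
    (g := fun α => Real.log (q α t)) (τ := τ) (w := w)
    (fun j => hmodel.pos _ _ (hu1 j))
    (fun j => abs_log_sub_log_le_quantileOscillation hfin (hu j) (hp j)
      (Metric.mem_closedBall_self hr) (hmodel.pos _ _ (hu1 j)) (hmodel.pos _ _ (hu1 j)))
    (fun j l hjl => Real.log_le_log (hmodel.pos _ _ (hu1 l))
      (quantile_anti (hmodel.quantile t) (hu1 j) (hu1 l) hjl))
    (fun j l hne hjl hl => ?_) hcard hi
  have hj0 := (hu1 j).1
  have hl0 := (hu1 l).1
  have h1 : u j < u l - 4 * w / γ t * τ := by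
    by_contra! h
    exact hsep j l hne hl ⟨h, hjl⟩
  have hs : 0 ≤ 4 * w / γ t := by positivity
  -- As `u l ≤ τ`, the absolute spacing $s\tau$ with $s = 4w/\gamma$ gives $u_j \le u_l(1-s) \le u_l
  -- e^{-s}$. The slope $\gamma/2$ then turns the logarithmic gap $s$ into $2w$.
  have h2 : u j ≤ u l * Real.exp (-(4 * w / γ t)) := by
    have h3 := Real.add_one_le_exp (-(4 * w / γ t))
    have h4 := mul_le_mul_of_nonneg_left h3 hl0.le
    have h5 := mul_le_mul_of_nonneg_left hl hs
    linarith
  have h6 : Real.log (u j) ≤ Real.log (u l) - 4 * w / γ t := by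
    have := Real.log_le_log hj0 h2
    rw [Real.log_mul hl0.ne' (Real.exp_pos _).ne', Real.log_exp] at this
    linarith
  have h7 : Real.log (q (u l) t) + γ t / 2 * Real.log (u l) ≤
      Real.log (q (u j) t) + γ t / 2 * Real.log (u j) :=
    hη ⟨hj0, (hjl.trans hl).trans_lt hτη⟩ ⟨hl0, hl.trans_lt hτη⟩ hjl
  have h8 := mul_le_mul_of_nonneg_left h6 (half_pos hγ).le
  have h9 : γ t / 2 * (4 * w / γ t) = 2 * w := by
    field_simp
    ring
  change Real.log (q (u l) t) + 2 * w ≤ Real.log (q (u j) t)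
  rw [mul_sub, h9] at h8
  linarith

/-- The probability that the largest responses do not occur at the design points with the
smallest uniform variables. -/
theorem measure_orderStat_rev_ne_le {E : Type*} [MetricSpace E] {μ : E → Measure ℝ}
    [∀ x, IsProbabilityMeasure (μ x)] {q : ℝ → E → ℝ} {γ : E → ℝ}
    (hmodel : IsHeavyTailedModel μ q γ) {t : E} {r a η τ : ℝ} (hr : 0 ≤ r) (ha : 0 ≤ a)
    (hη : AntitoneOn (fun α => Real.log (q α t) + γ t / 2 * Real.log α) (Ioo 0 η))
    (hτ : τ ∈ Icc (0 : ℝ) 1) (hτη : τ < η) (hfin : quantileOscillation q t r a ≠ ∞)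
    {m k : ℕ} (hk : k < m * τ) {p : Fin m → E} (hp : ∀ j, p j ∈ Metric.closedBall t r)
    {Ω : Type*} [MeasurableSpace Ω] {P : Measure Ω} [IsProbabilityMeasure P]
    {V Z : Fin m → Ω → ℝ} (hV : ∀ j, Measurable (V j)) (hind : iIndepFun V P)
    (hlaw : ∀ j, P.map (V j) = volume.restrict (Ioo (0 : ℝ) 1))
    (hZ : ∀ᵐ ω ∂P, ∀ j, q (V j ω) (p j) = Z j ω) :
    P {ω | ¬ ∀ i : Fin m, (i : ℕ) < k → orderStat (fun j => Z j ω) i.rev =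
        Z (Tuple.sort (fun j => V j ω) i) ω} ≤
      ENNReal.ofReal (2 * (m * a) +
        m ^ 2 * (4 * (quantileOscillation q t r a).toReal / γ t * τ * τ) +
        m * τ / (m * τ - k) ^ 2) := by
  have hγ := hmodel.index_pos t
  have hτ0 := hτ.1
  have hw0 : 0 ≤ (quantileOscillation q t r a).toReal := ENNReal.toReal_nonneg
  refine le_trans (measure_mono_ae ?_) (measure_uniform_not_regular_le hV hind hlaw ha
    (d := 4 * (quantileOscillation q t r a).toReal / γ t * τ) (by positivity) hτ hk)
  filter_upwards [hZ] with ω hω hbad hgood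
  apply hbad
  intro i hi
  have := orderStat_rev_eq_of_regular hmodel hr ha hη hτη hfin hp hgood.1 hgood.2.1
    hgood.2.2 hi
  simpa only [hω] using this

/-! ### Passage to the limit -/

/-- An iterated limit: the limit superior of the failure probability is at most `L C` for each fixed
`C`, and `C` is then sent to infinity. -/
theorem tendsto_measure_one_of_compl {Ω : ℕ → Type*} [∀ n, MeasurableSpace (Ω n)]
    {P : ∀ n, Measure (Ω n)} [∀ n, IsProbabilityMeasure (P n)] {A : ∀ n, Set (Ω n)}
    (hA : ∀ n, MeasurableSet (A n)) {B : ℝ → ℕ → ℝ} {L : ℝ → ℝ}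
    (hB : ∀ C, 2 ≤ C → Tendsto (B C) atTop (𝓝 (L C))) (hL : Tendsto L atTop (𝓝 0))
    (hle : ∀ C, 2 ≤ C → ∀ᶠ n in atTop, P n (A n)ᶜ ≤ ENNReal.ofReal (B C n)) :
    Tendsto (fun n => P n (A n)) atTop (𝓝 1) := by
  have h0 : Tendsto (fun n => P n (A n)ᶜ) atTop (𝓝 0) := by
    rw [ENNReal.tendsto_nhds_zero]
    intro ε hε
    obtain ⟨ε', hε'0, hε'⟩ : ∃ ε' : ℝ, 0 < ε' ∧ ENNReal.ofReal ε' ≤ ε := by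
      rcases eq_or_ne ε ∞ with rfl | htop
      · exact ⟨1, one_pos, le_top⟩
      · exact ⟨ε.toReal, ENNReal.toReal_pos hε.ne' htop, (ENNReal.ofReal_toReal htop).le⟩
    obtain ⟨C, hC, hC2⟩ := ((hL.eventually (gt_mem_nhds hε'0)).and (eventually_ge_atTop 2)).exists
    filter_upwards [hle C hC2, (hB C hC2).eventually (gt_mem_nhds hC)] with n h1 h2
    exact h1.trans ((ENNReal.ofReal_le_ofReal h2.le).trans hε')
  have h1 : (fun n => P n (A n)) = fun n => 1 - P n (A n)ᶜ := by
    ext n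
    rw [← prob_compl_eq_one_sub (hA n).compl, compl_compl]
  rw [h1]
  simpa using ENNReal.Tendsto.sub (tendsto_const_nhds (x := (1 : ℝ≥0∞))) h0
    (Or.inl ENNReal.one_ne_top)

/-- The probability integral transforms of the responses in the slice. -/
noncomputable def sliceUniform {E : Type*} [MetricSpace E] (μ : E → Measure ℝ) {n : ℕ}
    (x : Fin n → E) (t : E) (r : ℝ) (y : Fin n → ℝ) (j : Fin (sliceCard x t r)) : ℝ :=
  1 - cdf (μ (x ((slice x t r).orderEmbOfFin rfl j))) (sliceResponse x t r y j)

/-- The design points in the slice. -/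
noncomputable def slicePoint {E : Type*} [MetricSpace E] {n : ℕ} (x : Fin n → E) (t : E) (r : ℝ)
    (j : Fin (sliceCard x t r)) : E :=
  x ((slice x t r).orderEmbOfFin rfl j)

theorem slicePoint_mem {E : Type*} [MetricSpace E] {n : ℕ} (x : Fin n → E) (t : E) (r : ℝ)
    (j : Fin (sliceCard x t r)) : slicePoint x t r j ∈ Metric.closedBall t r := by
  have h : ∀ i ∈ slice x t r, x i ∈ Metric.closedBall t r := fun i hi => by
    simpa only [slice, Finset.mem_filter, Finset.mem_univ, true_and] using hi
  exact h _ ((slice x t r).orderEmbOfFin_mem rfl j)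

/-! ### Uniform variables attached to the slice -/

section Slice

variable {E : Type*} [MetricSpace E] {μ : E → Measure ℝ}
  {q : ℝ → E → ℝ} {γ : E → ℝ} {n : ℕ} (x : Fin n → E) (t : E) (r : ℝ)
  {Ω : Type*} [MeasurableSpace Ω] {P : Measure Ω} {Y : Fin n → Ω → ℝ}

theorem measurable_sliceResponse (hY : ∀ i, Measurable (Y i)) (j : Fin (sliceCard x t r)) :
    Measurable fun ω => sliceResponse x t r (fun i => Y i ω) j :=
  hY _

theorem measurable_sliceUniform (hY : ∀ i, Measurable (Y i)) (j : Fin (sliceCard x t r)) :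
    Measurable fun ω => sliceUniform μ x t r (fun i => Y i ω) j :=
  measurable_const.sub ((monotone_cdf _).measurable.comp (hY _))

theorem iIndepFun_sliceUniform (hind : iIndepFun Y P) :
    iIndepFun (fun j ω => sliceUniform μ x t r (fun i => Y i ω) j) P :=
  (hind.precomp ((slice x t r).orderEmbOfFin rfl).injective).comp
    (fun j y => 1 - cdf (μ (x ((slice x t r).orderEmbOfFin rfl j))) y)
    fun _ => measurable_const.sub (monotone_cdf _).measurable

variable [∀ x, IsProbabilityMeasure (μ x)]

theorem map_sliceUniform (hmodel : IsHeavyTailedModel μ q γ) (hY : ∀ i, Measurable (Y i))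
    (hlaw : ∀ i, P.map (Y i) = μ (x i)) (j : Fin (sliceCard x t r)) :
    P.map (fun ω => sliceUniform μ x t r (fun i => Y i ω) j) =
      volume.restrict (Ioo (0 : ℝ) 1) := by
  set i := (slice x t r).orderEmbOfFin rfl j
  have hm : Measurable fun y => 1 - cdf (μ (x i)) y :=
    measurable_const.sub (monotone_cdf _).measurable
  have h := map_one_sub_cdf (ν := μ (x i)) fun p hp => ⟨q (1 - p) (x i), by
    rw [hmodel.quantile _ _ ⟨by linarith [hp.2], by linarith [hp.1]⟩]; ring⟩
  calc P.map (fun ω => sliceUniform μ x t r (fun i => Y i ω) j)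
      = (P.map (Y i)).map fun y => 1 - cdf (μ (x i)) y := (Measure.map_map hm (hY i)).symm
    _ = volume.restrict (Ioo (0 : ℝ) 1) := by rw [hlaw i, h]

theorem ae_quantile_sliceUniform (hmodel : IsHeavyTailedModel μ q γ)
    (hY : ∀ i, Measurable (Y i)) (hlaw : ∀ i, P.map (Y i) = μ (x i)) :
    ∀ᵐ ω ∂P, ∀ j, q (sliceUniform μ x t r (fun i => Y i ω) j) (slicePoint x t r j) =
      sliceResponse x t r (fun i => Y i ω) j := by
  rw [ae_all_iff]
  intro j
  set i := (slice x t r).orderEmbOfFin rfl j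
  have h := ae_quantile_one_sub_cdf (hmodel.quantile (x i))
  rw [← hlaw i] at h
  have h' := ae_of_ae_map (hY i).aemeasurable h
  filter_upwards [h'] with ω hω
  rw [hlaw i] at hω
  exact hω

end Slice

/-! ### Asymptotics and the main theorem -/

theorem tendsto_atTop_of_tendsto_div {k m : ℕ → ℕ} (hk : ∀ᶠ n in atTop, 1 ≤ k n ∧ k n ≤ m n)
    (hkm : Tendsto (fun n => (k n : ℝ) / (m n : ℝ)) atTop (𝓝 0)) :
    Tendsto (fun n => (m n : ℝ)) atTop atTop := by
  have hpos : ∀ᶠ n in atTop, (0 : ℝ) < m n := by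
    filter_upwards [hk] with n hn
    exact_mod_cast hn.1.trans hn.2
  have hinv : Tendsto (fun n => (m n : ℝ)⁻¹) atTop (𝓝 0) := by
    refine tendsto_of_tendsto_of_tendsto_of_le_of_le' tendsto_const_nhds hkm
      (Eventually.of_forall fun n => by positivity) ?_
    filter_upwards [hk, hpos] with n hn h0
    rw [inv_eq_one_div]
    exact div_le_div_of_nonneg_right (by exact_mod_cast hn.1) h0.le
  have : Tendsto (fun n => (m n : ℝ)⁻¹) atTop (𝓝[>] 0) :=
    tendsto_nhdsWithin_iff.2 ⟨hinv, hpos.mono fun n hn => inv_pos.2 hn⟩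
  exact this.inv_tendsto_nhdsGT_zero.congr fun n => inv_inv _

/-- The Chebyshev term with $m\tau = C\kappa$. The bound is uniform in $\kappa \ge 1$, so $k$ need
not tend to infinity. -/
theorem mul_div_sq_le {C κ : ℝ} (hC : 2 ≤ C) (hκ : 1 ≤ κ) :
    C * κ / (C * κ - κ) ^ 2 ≤ 4 / C := by
  have h1 : 0 < C * κ - κ := by nlinarith
  rw [div_le_div_iff₀ (by positivity) (by linarith)]
  have h2 : C ≤ 2 * (C - 1) := by linarith
  have h3 : C ^ 2 ≤ (2 * (C - 1)) ^ 2 := pow_le_pow_left₀ (by linarith) h2 2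
  have h4 : κ ≤ κ ^ 2 := by nlinarith
  calc C * κ * C = C ^ 2 * κ := by ring
    _ ≤ (2 * (C - 1)) ^ 2 * κ ^ 2 := by gcongr
    _ = 4 * (C * κ - κ) ^ 2 := by ring

theorem proposition1
    {E : Type*} [MetricSpace E] [MeasurableSpace E] [BorelSpace E]
    -- the conditional laws, quantiles and tail index, and the point of interest
    (μ : E → Measure ℝ) [∀ x, IsProbabilityMeasure (μ x)] (q : ℝ → E → ℝ) (γ : E → ℝ)
    (hmodel : IsHeavyTailedModel μ q γ) (t : E) (hA : IsSmoothTail q γ t)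
    -- the radii, the nonrandom design, and the independent responses
    (h : ℕ → ℝ) (hpos : ∀ n, 0 < h n) (hlim : Tendsto h atTop (𝓝 0))
    (x : ∀ n, Fin n → E)
    {Ω : ℕ → Type*} [∀ n, MeasurableSpace (Ω n)]
    (P : ∀ n, Measure (Ω n)) [∀ n, IsProbabilityMeasure (P n)]
    (Y : ∀ n, Fin n → Ω n → ℝ) (hYmeas : ∀ n i, Measurable (Y n i))
    (hYindep : ∀ n, iIndepFun (Y n) (P n))
    (hYlaw : ∀ n i, (P n).map (Y n i) = μ (x n i))
    -- the number of largest observations, among those in the slice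
    (k : ℕ → ℕ) (hk : ∀ᶠ n in atTop, 1 ≤ k n ∧ k n ≤ sliceCard (x n) t (h n))
    (hkm : Tendsto (fun n => (k n : ℝ) / (sliceCard (x n) t (h n) : ℝ)) atTop (𝓝 0))
    (δ : ℝ) (hδ : 0 < δ)
    (hosc : Tendsto
      (fun n => (k n : ℝ≥0∞) ^ 2 *
        quantileOscillation q t (h n) ((sliceCard (x n) t (h n) : ℝ) ^ (-(1 + δ))))
      atTop (𝓝 0)) :
    ∃ (A : ∀ n, Set (Ω n))
      (V : ∀ n, Fin (sliceCard (x n) t (h n)) → Ω n → ℝ)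
      (T : ∀ n, Fin (k n) → Ω n → E),
      (∀ n, MeasurableSet (A n)) ∧
      Tendsto (fun n => P n (A n)) atTop (𝓝 1) ∧
      -- the `V n i` are independent and uniformly distributed on `(0, 1)`
      (∀ n i, Measurable (V n i)) ∧
      (∀ n, iIndepFun (V n) (P n)) ∧
      (∀ n i, (P n).map (V n i) = volume.restrict (Ioo (0 : ℝ) 1)) ∧
      -- the `T n i` are random variables in the ball
      (∀ n i, Measurable (T n i)) ∧
      (∀ n i ω, T n i ω ∈ Metric.closedBall t (h n)) ∧
      -- equality in law, given `A n`, of the two random vectors of length `k n`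
      (∀ n (hn : k n ≤ sliceCard (x n) t (h n)),
        IdentDistrib
          (fun ω (i : Fin (k n)) => Real.log
            (orderStat (sliceResponse (x n) t (h n) (fun j => Y n j ω))
              (Fin.rev (Fin.castLE hn i))))
          (fun ω (i : Fin (k n)) => Real.log
            (q (orderStat (fun j => V n j ω) (Fin.castLE hn i)) (T n i ω)))
          ((P n)[|A n]) ((P n)[|A n])) := by
  obtain ⟨η, hη, hanti⟩ := hA.exists_antitoneOn hmodel
  have hγ := hmodel.index_pos t
  let m : ℕ → ℕ := fun n => sliceCard (x n) t (h n)
  let V : ∀ n, Fin (m n) → Ω n → ℝ := fun n j ω =>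
    sliceUniform μ (x n) t (h n) (fun i => Y n i ω) j
  let Z : ∀ n, Fin (m n) → Ω n → ℝ := fun n j ω =>
    sliceResponse (x n) t (h n) (fun i => Y n i ω) j
  have hVm : ∀ n j, Measurable (V n j) := fun n j => measurable_sliceUniform _ _ _ (hYmeas n) j
  have hZm : ∀ n j, Measurable (Z n j) := fun n j => measurable_sliceResponse _ _ _ (hYmeas n) j
  have hVind : ∀ n, iIndepFun (V n) (P n) := fun n => iIndepFun_sliceUniform _ _ _ (hYindep n)
  have hVlaw : ∀ n j, (P n).map (V n j) = volume.restrict (Ioo (0 : ℝ) 1) := fun n j =>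
    map_sliceUniform _ _ _ hmodel (hYmeas n) (hYlaw n) j
  have hZV : ∀ n, ∀ᵐ ω ∂(P n), ∀ j, q (V n j ω) (slicePoint (x n) t (h n) j) = Z n j ω :=
    fun n => ae_quantile_sliceUniform _ _ _ hmodel (hYmeas n) (hYlaw n)
  let σ : ∀ n, Ω n → Equiv.Perm (Fin (m n)) := fun n ω => Tuple.sort fun j => V n j ω
  have hZσ : ∀ n i, Measurable fun ω => Z n (σ n ω i) ω := fun n i =>
    Measurable.apply_sort (hZm n) (measurable_pi_lambda _ (hVm n)) i
  have hZo : ∀ n i, Measurable fun ω => orderStat (fun j => Z n j ω) i := fun n i =>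
    (measurable_orderStat i).comp (measurable_pi_lambda _ (hZm n))
  let A : ∀ n, Set (Ω n) := fun n =>
    {ω | ∀ i : Fin (m n), (i : ℕ) < k n → orderStat (fun j => Z n j ω) i.rev = Z n (σ n ω i) ω}
  have hAm : ∀ n, MeasurableSet (A n) := by
    intro n
    have : A n = ⋂ i : Fin (m n), ⋂ _ : (i : ℕ) < k n,
        {ω | orderStat (fun j => Z n j ω) i.rev = Z n (σ n ω i) ω} := by
      ext ω
      simp [A]
    rw [this]
    exact MeasurableSet.iInter fun i => MeasurableSet.iInter fun _ =>
      measurableSet_eq_fun (hZo n _) (hZσ n i)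
  let T : ∀ n, Fin (k n) → Ω n → E := fun n i ω =>
    if hn : k n ≤ m n then slicePoint (x n) t (h n) (σ n ω (Fin.castLE hn i)) else t
  refine ⟨A, V, T, hAm, ?_, hVm, hVind, hVlaw, ?_, ?_, ?_⟩
  · set a : ℕ → ℝ := fun n => (m n : ℝ) ^ (-(1 + δ)) with ha
    set w : ℕ → ℝ := fun n => (quantileOscillation q t (h n) (a n)).toReal with hw
    have hmtop := tendsto_atTop_of_tendsto_div hk hkm
    have hma : Tendsto (fun n => m n * a n) atTop (𝓝 0) := by
      refine ((tendsto_rpow_neg_atTop hδ).comp hmtop).congr' ?_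
      filter_upwards [hmtop.eventually_gt_atTop 0] with n hn
      have h1 : (0 : ℝ) < m n := hn
      simp only [ha, Function.comp_apply]
      rw [neg_add, Real.rpow_add h1, Real.rpow_neg_one, ← mul_assoc, mul_inv_cancel₀ h1.ne',
        one_mul]
    have hkw : Tendsto (fun n => (k n : ℝ) ^ 2 * w n) atTop (𝓝 0) := by
      have := (ENNReal.tendsto_toReal ENNReal.zero_ne_top).comp hosc
      refine Tendsto.congr (fun n => ?_) this
      simp [hw, ENNReal.toReal_mul, ha, m]
    -- As `k n ≥ 1`, an infinite oscillation would make the product in `hosc` infinite.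
    have hfin : ∀ᶠ n in atTop, quantileOscillation q t (h n) (a n) ≠ ∞ := by
      filter_upwards [hosc.eventually (gt_mem_nhds one_pos), hk] with n hn hkn htop
      have hk0 : (k n : ℝ≥0∞) ^ 2 ≠ 0 := pow_ne_zero _ (by simpa using by omega)
      have htop' : quantileOscillation q t (h n)
          ((sliceCard (x n) t (h n) : ℝ) ^ (-(1 + δ))) = ∞ := htop
      rw [htop', ENNReal.mul_top hk0] at hn
      exact absurd hn (by simp)
    -- The terms of `B` account for uniforms outside `(a, 1 - a)`, close pairs below `τ = C * k /
    -- m`, and too few points below `τ`. Only the last survives as `n` grows.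
    refine tendsto_measure_one_of_compl hAm
      (B := fun C n => 2 * (m n * a n) + C ^ 2 * (4 / γ t) * ((k n : ℝ) ^ 2 * w n) + 4 / C)
      (L := fun C => 4 / C) (fun C _ => ?_) (tendsto_const_nhds.div_atTop tendsto_id)
      (fun C hC => ?_)
    · simpa using ((hma.const_mul 2).add (hkw.const_mul (C ^ 2 * (4 / γ t)))).add_const (4 / C)
    · have hτ0 : Tendsto (fun n => C * ((k n : ℝ) / m n)) atTop (𝓝 0) := by
        simpa using hkm.const_mul C
      filter_upwards [hfin, hk, hmtop.eventually_gt_atTop 0,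
        hτ0.eventually (gt_mem_nhds hη.1)] with n hfinn hkn hmn hτn
      have hm0 : (0 : ℝ) < m n := hmn
      have hk1 : (1 : ℝ) ≤ k n := by exact_mod_cast hkn.1
      have hmτ : m n * (C * ((k n : ℝ) / m n)) = C * k n := by
        field_simp
      have hτmem : C * ((k n : ℝ) / m n) ∈ Icc (0 : ℝ) 1 :=
        ⟨by positivity, (hτn.trans hη.2).le⟩
      refine (measure_orderStat_rev_ne_le hmodel (hpos n).le (a := a n)
        (Real.rpow_nonneg hm0.le _) hanti hτmem hτn hfinn (k := k n) (by rw [hmτ]; nlinarith)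
        (slicePoint_mem (x n) t (h n)) (hVm n) (hVind n) (hVlaw n) (hZV n)).trans ?_
      refine ENNReal.ofReal_le_ofReal ?_
      have h1 : (m n : ℝ) ^ 2 * (4 * w n / γ t * (C * ((k n : ℝ) / m n)) *
          (C * ((k n : ℝ) / m n))) = C ^ 2 * (4 / γ t) * ((k n : ℝ) ^ 2 * w n) := by
        field_simp
      have h2 := mul_div_sq_le hC hk1
      change 2 * (m n * a n) + (m n : ℝ) ^ 2 * (4 * w n / γ t * (C * ((k n : ℝ) / m n)) *
        (C * ((k n : ℝ) / m n))) + m n * (C * ((k n : ℝ) / m n)) /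
        (m n * (C * ((k n : ℝ) / m n)) - k n) ^ 2 ≤ _
      rw [h1, hmτ]
      linarith
  · intro n i
    by_cases hn : k n ≤ m n
    · simp only [T, hn, dite_true]
      exact Measurable.apply_sort (z := fun j _ => slicePoint (x n) t (h n) j)
        (fun _ => measurable_const) (measurable_pi_lambda _ (hVm n)) _
    · simp only [T, hn, dite_false]
      exact measurable_const
  · intro n i ω
    by_cases hn : k n ≤ m n
    · simp only [T, hn, dite_true]
      exact slicePoint_mem _ _ _ _
    · simp only [T, hn, dite_false]
      exact Metric.mem_closedBall_self (hpos n).le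
  · intro n hn
    -- The vectors agree almost surely given `A n`, since the order statistic of `V` at rank `i` is
    -- by definition `V` at index `σ n ω i`. If `A n` is null, the conditional measure is zero.
    refine IdentDistrib.of_ae_eq (measurable_pi_lambda _ fun i =>
      Real.measurable_log.comp (hZo n _)).aemeasurable ?_
    filter_upwards [ae_cond_mem (hAm n), cond_absolutelyContinuous.ae_le (hZV n)] with ω hω hq
    funext i
    have h1 := hω (Fin.castLE hn i) i.2
    have h2 := hq (σ n ω (Fin.castLE hn i))
    have hT : T n i ω = slicePoint (x n) t (h n) (σ n ω (Fin.castLE hn i)) := dif_pos hn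
    rw [hT]
    exact congrArg Real.log (h1.trans h2.symm)
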